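/- Let $F$ be a number field with algebraic closure $\overline F$, let $A$ be an elliptic curve over $F$ (given by a Weierstrass equation), let $\ell$ be a prime, and let $\alpha\in A(F)$. Put $T_\infty=\bigcup_{n}F(A[\ell^n])$, and let $T_\ell(A)=\varprojlim A[\ell^n]$ be the $\ell$-adic Tate module, where $A[m]$ denotes the $m$-torsion of $A(\overline F)$. Choose a $\mathbb Z_\ell$-basis of $T_\ell(A)$, identifying $T_\ell(A)$ with $\mathbb Z_\ell^2$ and its automorphism group with $\mathrm{GL}_2(\mathbb Z_\ell)$, and let $\rho:\mathrm{Gal}(T_\infty/F)\to \mathrm{GL}_2(\mathbb Z_\ell)$ be the representation given by the Galois action on $T_\ell(A)$. Choose points $\beta_n\in A(\overline F)$ ($n\ge 0$) with $\beta_0=\alpha$ and $\ell\beta_{n+1}=\beta_n$ for all $n$, put $K_\infty=\bigcup_n F(A[\ell^n])\,F(\beta_n)$, and let $\kappa:\mathrm{Gal}(K_\infty/T_\infty)\to T_\ell(A)\cong\mathbb Z_\ell^2$ be the Kummer map $\sigma\mapsto(\sigma(\beta_n)-\beta_n)_{n}$. Suppose that $\rho$ is surjective. Then $\kappa$ is surjective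 if and only if both of the following conditions hold: 1. $\alpha\notin \ell A(F)$; 2. if $\ell=2$, then $F(\beta_1)\not\subseteq F(A[4])$. -/

import Mathlib

open WeierstrassCurve.Affine
open scoped Classical

noncomputable section

/-! ### Tate modules -/

section Tate

/-- The `ℓ`-adic Tate module `T_ℓ(M) = lim M[ℓ ^ n]` of an additive commutative group `M`, realised
as the group of sequences `(x_n)` with `x_0 = 0` and `ℓ • x_{n+1} = x_n`. -/
def TateModule (ℓ : ℕ) (M : Type*) [AddCommGroup M] : AddSubgroup (ℕ → M) where
  carrier := {x | x 0 = 0 ∧ ∀ n, ℓ • x (n + 1) = x n}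
  zero_mem' := ⟨rfl, fun _ => smul_zero _⟩
  add_mem' := by
    rintro x y ⟨hx0, hx⟩ ⟨hy0, hy⟩
    exact ⟨by simp [hx0, hy0], fun n => by simp [smul_add, hx n, hy n]⟩
  neg_mem' := by
    rintro x ⟨hx0, hx⟩
    exact ⟨by simp [hx0], fun n => by simp [smul_neg, hx n]⟩

variable {ℓ : ℕ} {M : Type*} [AddCommGroup M]

theorem TateModule.pow_smul_eq_zero (x : TateModule ℓ M) (n : ℕ) : ℓ ^ n • x.1 n = 0 := by
  induction n with
  | zero => simpa using x.2.1
  | succ n ih => rw [pow_succ, mul_smul, x.2.2 n, ih]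

theorem nsmul_eq_nsmul_of_zmod {N a b : ℕ} {y : M} (hy : N • y = 0)
    (h : (a : ZMod N) = (b : ZMod N)) : a • y = b • y := by
  rw [nsmul_eq_nsmul_iff_modEq]
  exact ((ZMod.natCast_eq_natCast_iff a b N).1 h).of_dvd (addOrderOf_dvd_of_nsmul_eq_zero hy)

variable [hℓ : Fact ℓ.Prime]

/-- `ℤ_ℓ` acts on `T_ℓ(M)` by letting `a` act on `M[ℓ ^ n]` through `a mod ℓ ^ n`. -/
instance : SMul ℤ_[ℓ] (TateModule ℓ M) where
  smul a x := ⟨fun n => (PadicInt.toZModPow n a).val • x.1 n, by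
    refine ⟨by simp [x.2.1], fun n => ?_⟩
    dsimp only
    rw [smul_comm, x.2.2 n]
    refine nsmul_eq_nsmul_of_zmod (TateModule.pow_smul_eq_zero x n) ?_
    rw [ZMod.natCast_zmod_val, ZMod.natCast_val, PadicInt.cast_toZModPow n (n + 1) n.le_succ]⟩

theorem TateModule.smul_apply (a : ℤ_[ℓ]) (x : TateModule ℓ M) (n : ℕ) :
    (a • x).1 n = (PadicInt.toZModPow n a).val • x.1 n := rfl

instance : Module ℤ_[ℓ] (TateModule ℓ M) where
  one_smul x := by
    ext n
    rw [TateModule.smul_apply]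
    conv_rhs => rw [← one_smul ℕ (x.1 n)]
    exact nsmul_eq_nsmul_of_zmod (TateModule.pow_smul_eq_zero x n)
      (by simp only [ZMod.natCast_zmod_val, map_one, Nat.cast_one])
  mul_smul a b x := by
    ext n
    simp only [TateModule.smul_apply, smul_smul]
    exact nsmul_eq_nsmul_of_zmod (TateModule.pow_smul_eq_zero x n)
      (by simp only [ZMod.natCast_zmod_val, map_mul, Nat.cast_mul])
  smul_zero a := by
    ext n
    rw [TateModule.smul_apply]
    simp
  smul_add a x y := by
    ext n
    simp [TateModule.smul_apply, smul_add]
  add_smul a b x := by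
    ext n
    simp only [TateModule.smul_apply, AddSubgroup.coe_add, Pi.add_apply, ← add_smul]
    exact nsmul_eq_nsmul_of_zmod (TateModule.pow_smul_eq_zero x n)
      (by simp only [ZMod.natCast_zmod_val, map_add, Nat.cast_add])
  zero_smul x := by
    ext n
    simp [TateModule.smul_apply]

end Tate

/-! ### Points over the algebraic closure and the fields they generate -/

section Curve

variable {F : Type*} [Field F]

/-- The group of points of the Weierstrass curve `W` over the algebraic closure of `F`. -/
abbrev GeomPoint (W : WeierstrassCurve F) : Type _ := (W⁄(AlgebraicClosure F)).Point

variable {W : WeierstrassCurve F}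

/-- The set of affine coordinates of a point (empty for the point at infinity). -/
def coords : GeomPoint W → Set (AlgebraicClosure F)
  | .zero => ∅
  | .some x y _ => {x, y}

/-- `F(P)`, the field generated over `F` by the coordinates of `P`. -/
def pointField (P : GeomPoint W) : IntermediateField F (AlgebraicClosure F) :=
  IntermediateField.adjoin F (coords P)

/-- `F(A[m])`, the field generated over `F` by the coordinates of all `m`-torsion points. -/
def torsionField (W : WeierstrassCurve F) (m : ℕ) : IntermediateField F (AlgebraicClosure F) :=
  IntermediateField.adjoin F (⋃ P ∈ {P : GeomPoint W | m • P = 0}, coords P)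

/-- `T_∞ = ⋃ F(A[ℓ ^ n])`. -/
def torsionFieldInfty (W : WeierstrassCurve F) (ℓ : ℕ) :
    IntermediateField F (AlgebraicClosure F) :=
  ⨆ n : ℕ, torsionField W (ℓ ^ n)

/-- `K_∞ = ⋃ K_n`, where `K_n = F(A[ℓ ^ n]) · F(β_n)`. -/
def kummerFieldInfty (ℓ : ℕ) (β : ℕ → GeomPoint W) : IntermediateField F (AlgebraicClosure F) :=
  ⨆ n : ℕ, torsionField W (ℓ ^ n) ⊔ pointField (β n)

theorem torsionFieldInfty_le_kummerFieldInfty (ℓ : ℕ) (β : ℕ → GeomPoint W) :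
    torsionFieldInfty W ℓ ≤ kummerFieldInfty ℓ β :=
  iSup_mono fun _ => le_sup_left

theorem pointField_le_torsionField {m : ℕ} {P : GeomPoint W} (hP : m • P = 0) :
    pointField P ≤ torsionField W m :=
  IntermediateField.adjoin.mono F _ _ (Set.subset_biUnion_of_mem (u := coords) hP)

theorem pointField_tate_le {ℓ : ℕ} (x : TateModule ℓ (GeomPoint W)) (n : ℕ) :
    pointField (x.1 n) ≤ torsionFieldInfty W ℓ :=
  (pointField_le_torsionField (TateModule.pow_smul_eq_zero x n)).trans
    (le_iSup (fun n => torsionField W (ℓ ^ n)) n)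

/-- The subgroup `A(L)` of `A(F̄)`, for an intermediate field `L` of `F̄ / F`. -/
def pointsOver (W : WeierstrassCurve F) (L : IntermediateField F (AlgebraicClosure F)) :
    AddSubgroup (GeomPoint W) :=
  (Point.map (W' := W) L.val).range

theorem mem_pointsOver {L : IntermediateField F (AlgebraicClosure F)} {P : GeomPoint W}
    (hP : pointField P ≤ L) : P ∈ pointsOver W L := by
  rcases P with _ | ⟨x, y, h⟩
  · exact zero_mem _
  · have hx : x ∈ L := hP (IntermediateField.subset_adjoin F _ (by simp [coords]))
    have hy : y ∈ L := hP (IntermediateField.subset_adjoin F _ (by simp [coords]))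
    exact ⟨.some (⟨x, hx⟩ : L) ⟨y, hy⟩
      ((WeierstrassCurve.Affine.baseChange_nonsingular W (f := L.val) L.val.injective ⟨x, hx⟩ ⟨y, hy⟩).1 h), rfl⟩

/-- The identification of the group of `L`-rational points of `W` with the subgroup `A(L)`. -/
def pointsOverEquiv (W : WeierstrassCurve F) (L : IntermediateField F (AlgebraicClosure F)) :
    (W⁄L).Point ≃+ pointsOver W L :=
  AddMonoidHom.ofInjective (Point.map_injective (W' := W) L.val)

/-- The action of `Gal(L/F)` on `A(L) ⊆ A(F̄)` through the coordinates. -/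
def galAct {L : IntermediateField F (AlgebraicClosure F)} (σ : L ≃ₐ[F] L) :
    pointsOver W L →+ pointsOver W L :=
  (pointsOverEquiv W L).toAddMonoidHom.comp
    ((Point.map (W' := W) (σ : L →ₐ[F] L)).comp (pointsOverEquiv W L).symm.toAddMonoidHom)

theorem galAct_one {L : IntermediateField F (AlgebraicClosure F)} (P : pointsOver W L) :
    galAct (1 : L ≃ₐ[F] L) P = P := by
  obtain ⟨Q, rfl⟩ := (pointsOverEquiv W L).surjective P
  simp only [galAct, AddMonoidHom.comp_apply, AddEquiv.coe_toAddMonoidHom,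
    AddEquiv.symm_apply_apply, EmbeddingLike.apply_eq_iff_eq]
  cases Q <;> rfl

theorem galAct_mul {L : IntermediateField F (AlgebraicClosure F)} (σ τ : L ≃ₐ[F] L)
    (P : pointsOver W L) : galAct (σ * τ) P = galAct σ (galAct τ P) := by
  obtain ⟨Q, rfl⟩ := (pointsOverEquiv W L).surjective P
  simp only [galAct, AddMonoidHom.comp_apply, AddEquiv.coe_toAddMonoidHom,
    AddEquiv.symm_apply_apply, EmbeddingLike.apply_eq_iff_eq]
  rw [Point.map_map]
  rfl

/-- `galAct` is computed on coordinates. -/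
theorem galAct_some {L : IntermediateField F (AlgebraicClosure F)} (σ : L ≃ₐ[F] L) (x y : L)
    (h : (W⁄L).Nonsingular x y) :
    galAct σ (pointsOverEquiv W L (.some x y h)) =
      pointsOverEquiv W L (.some (σ x) (σ y)
        ((WeierstrassCurve.Affine.baseChange_nonsingular W (f := (σ : L →ₐ[F] L)) σ.injective x y).2 h)) := by
  simp only [galAct, AddMonoidHom.comp_apply, AddEquiv.coe_toAddMonoidHom,
    AddEquiv.symm_apply_apply]
  rfl

theorem galAct_baseChange {L : IntermediateField F (AlgebraicClosure F)} (σ : L ≃ₐ[F] L)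
    (α : (W⁄F).Point) {P : pointsOver W L}
    (hP : P.1 = Point.baseChange F (AlgebraicClosure F) α) : galAct σ P = P := by
  have h : P = pointsOverEquiv W L (Point.baseChange F L α) := by
    refine Subtype.ext (hP.trans ?_)
    exact (Point.map_baseChange (W' := W) L.val α).symm
  rw [h]
  simp only [galAct, AddMonoidHom.comp_apply, AddEquiv.coe_toAddMonoidHom,
    AddEquiv.symm_apply_apply, EmbeddingLike.apply_eq_iff_eq]
  exact Point.map_baseChange (W' := W) (σ : L →ₐ[F] L) α

/-! ### The `ℓ`-adic representation -/

variable (W) (ℓ : ℕ) [hℓ : Fact ℓ.Prime]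

/-- The torsion representation `Gal(T_∞/F) → End_{ℤ_ℓ}(T_ℓ(A))` (with image in the units
`Aut(T_ℓ(A))`), where `σ` acts on the Tate module termwise. -/
def torsionRep : (torsionFieldInfty W ℓ ≃ₐ[F] torsionFieldInfty W ℓ) →*
    Module.End ℤ_[ℓ] (TateModule ℓ (GeomPoint W)) where
  toFun σ :=
    { toFun := fun x =>
        ⟨fun n => (galAct σ ⟨x.1 n, mem_pointsOver (pointField_tate_le x n)⟩).1, by
          constructor
          · have h : (⟨x.1 0, mem_pointsOver (pointField_tate_le x 0)⟩ :
                pointsOver W (torsionFieldInfty W ℓ)) = 0 := Subtype.ext x.2.1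
            exact congrArg Subtype.val ((congrArg (galAct σ) h).trans (map_zero _))
          · intro n
            dsimp only
            rw [← AddSubgroup.coe_nsmul, ← map_nsmul]
            congr 2
            exact Subtype.ext (x.2.2 n)⟩
      map_add' := fun x y => by
        ext n
        simp only [AddSubgroup.coe_add, Pi.add_apply]
        rw [← AddSubgroup.coe_add, ← map_add]
        rfl
      map_smul' := fun a x => by
        ext n
        simp only [RingHom.id_apply, TateModule.smul_apply]
        rw [← AddSubgroup.coe_nsmul, ← map_nsmul]
        rfl }
  map_one' := by
    ext x n
    exact congrArg Subtype.val (galAct_one _)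
  map_mul' σ τ := by
    ext x n
    exact congrArg Subtype.val (galAct_mul σ τ _)

variable {W ℓ}

/-- The `ℓ`-adic representation `ρ : Gal(T_∞/F) → GL₂(ℤ_ℓ)` attached to a `ℤ_ℓ`-basis of the Tate
module. -/
def ladicRep (b : Module.Basis (Fin 2) ℤ_[ℓ] (TateModule ℓ (GeomPoint W))) :
    (torsionFieldInfty W ℓ ≃ₐ[F] torsionFieldInfty W ℓ) →* Matrix.GeneralLinearGroup (Fin 2) ℤ_[ℓ] :=
  (Units.map (LinearMap.toMatrixAlgEquiv b : _ →* Matrix (Fin 2) (Fin 2) ℤ_[ℓ])).comp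
    (torsionRep W ℓ).toHomUnits

/-! ### The Kummer map -/

/-- `β` is a compatible choice of `ℓ`-power division points of `α`: `β_0 = α`, `ℓ • β_{n+1} = β_n`. -/
structure IsDivisionSequence (ℓ : ℕ) (α : (W⁄F).Point) (β : ℕ → GeomPoint W) : Prop where
  zero : β 0 = Point.baseChange F (AlgebraicClosure F) α
  succ : ∀ n, ℓ • β (n + 1) = β n

/-- `Gal(K_∞/T_∞)`, as the subgroup of `Gal(K_∞/F)` of the automorphisms fixing `T_∞`. -/
abbrev kummerGroup (ℓ : ℕ) (β : ℕ → GeomPoint W) :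
    Subgroup (kummerFieldInfty ℓ β ≃ₐ[F] kummerFieldInfty ℓ β) :=
  (IntermediateField.restrict (torsionFieldInfty_le_kummerFieldInfty ℓ β)).fixingSubgroup

theorem mem_pointsOver_kummer (ℓ : ℕ) (β : ℕ → GeomPoint W) (n : ℕ) :
    β n ∈ pointsOver W (kummerFieldInfty ℓ β) :=
  mem_pointsOver (le_sup_right.trans
    (le_iSup (fun n : ℕ => torsionField W (ℓ ^ n) ⊔ pointField (β n)) n))

/-- The Kummer map `Gal(K_∞/T_∞) → T_ℓ(A)`, `σ ↦ (σ(β_n) - β_n)_n`. -/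
def kummerMap {α : (W⁄F).Point} {β : ℕ → GeomPoint W} (hβ : IsDivisionSequence ℓ α β)
    (σ : kummerGroup ℓ β) : TateModule ℓ (GeomPoint W) :=
  ⟨fun n => (galAct σ.1 ⟨β n, mem_pointsOver_kummer ℓ β n⟩).1 - β n, by
    refine ⟨?_, fun n => ?_⟩
    · exact sub_eq_zero.2 (congrArg Subtype.val (galAct_baseChange σ.1 α (P := ⟨β 0, _⟩) hβ.zero))
    · dsimp only
      rw [nsmul_sub, ← AddSubgroup.coe_nsmul, ← map_nsmul, hβ.succ n]
      congr 3
      exact Subtype.ext (hβ.succ n)⟩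

/-- The Kummer map `κ : Gal(K_∞/T_∞) → T_ℓ(A) ≅ ℤ_ℓ²`, in the coordinates of a `ℤ_ℓ`-basis of the
Tate module. -/
def kummerMapCoord (b : Module.Basis (Fin 2) ℤ_[ℓ] (TateModule ℓ (GeomPoint W)))
    {α : (W⁄F).Point} {β : ℕ → GeomPoint W} (hβ : IsDivisionSequence ℓ α β)
    (σ : kummerGroup ℓ β) : Fin 2 → ℤ_[ℓ] :=
  b.equivFun (kummerMap hβ σ)

end Curve

end

/-!
The Galois groups are replaced by the absolute Galois group `G` of `F`, which acts on the geometric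
points, maps onto `GL₂(ℤ_ℓ)` by the hypothesis on `ρ` (`absRep`), and carries the Kummer cocycle
`σ ↦ (σ(β_n) - β_n)_n` with values in the Tate module `T` (`kummerCocycle`). On the kernel `N` of
`G → GL₂(ℤ_ℓ)` this cocycle is a homomorphism, and it induces the Kummer map.

The image of `N` in `T ≅ ℤ_ℓ²` is a subgroup stable under all of `GL₂(ℤ_ℓ)`. If it contains a
vector outside `ℓT`, elementary matrices show that it is everything (`eq_top_of_mulVec_mem`).
Hence the Kummer map is surjective if and only if `β_1` is not defined over `T_∞`
(`surjective_kummerMapCoord_iff`).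

Suppose now that `β_1` is defined over `T_∞`. Then `c(σ) = σ(β_1) - β_1` depends only on the image of
`σ` in `GL₂(ℤ_ℓ)`. If `ℓ` is odd, the central element `-1` forces `c` to be a coboundary
(`exists_eq_sub_of_central_neg`), so that `β_1` can be moved by an `ℓ`-torsion point to a rational
point and `α ∈ ℓ A(F)`. If `ℓ = 2`, then `c` restricted to the matrices congruent to `1` modulo `2` is
an equivariant homomorphism, and it vanishes on those congruent to `1` modulo `4`
(`cocycle_eq_zero_of_congrOne_four`), so that `β_1` is defined over `F(A[4])`. The converse
implications are immediate, since `A[ℓ]` and `A[4]` are defined over `T_∞`.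

It has to be known that `N` fixes all of `T_∞`, that is, that every `ℓ`-power torsion point is a
term of an element of `T`. This follows from the divisibility of `A(F̄)` by `ℓ`
(`exists_nsmul_eq_of_isAlgClosed`), which is obtained without formulas for multiplication by `ℓ`:
over an algebraically closed extension of transcendence degree one, the points not defined over
`F̄` are conjugate up to sign under endomorphisms over `F̄`, and multiplication by `ℓ` preserves
this set of points.
-/

/-! ### Divisibility of the group of points over an algebraically closed field -/

/-- An element which is algebraic over an algebraically closed subfield lies in that subfield. -/
theorem mem_range_algebraMap_of_isAlgebraic {K Ω : Type*} [Field K] [IsAlgClosed K] [Field Ω]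
    [Algebra K Ω] {x : Ω} (hx : IsAlgebraic K x) : x ∈ (algebraMap K Ω).range :=
  minpoly.mem_range_of_degree_eq_one K x
    (IsAlgClosed.degree_eq_one_of_irreducible K (minpoly.irreducible hx.isIntegral))

/-- In an algebraically closed extension of transcendence degree at most one, any transcendental
element is sent to any other one by an endomorphism of the extension. -/
theorem exists_algHom_apply_eq_of_transcendental {K Ω : Type*} [Field K] [Field Ω] [IsAlgClosed Ω]
    [Algebra K Ω] (htr : Algebra.trdeg K Ω ≤ 1) {x y : Ω} (hx : Transcendental K x)
    (hy : Transcendental K y) : ∃ σ : Ω →ₐ[K] Ω, σ x = y := by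
  have hb : IsTranscendenceBasis K (fun _ : Unit => x) := by
    refine ((algebraicIndependent_unique_type_iff (R := K)).2
      hx).isTranscendenceBasis_of_lift_trdeg_le_of_finite ?_
    simpa using htr
  have := hb.isAlgebraic_field
  rw [Set.range_const] at this
  let φ : IntermediateField.adjoin K {x} →ₐ[K] Ω :=
    (IntermediateField.val _).comp (((RatFunc.algEquivOfTranscendental x hx).symm.trans
      (RatFunc.algEquivOfTranscendental y hy)).toAlgHom)
  have hφ : φ (IntermediateField.AdjoinSimple.gen K x) = y := by
    simp [φ]
  obtain ⟨σ, hσ⟩ := IsAlgClosed.surjective_domRestrict_of_isAlgebraic (E := Ω) φ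
  refine ⟨σ, ?_⟩
  rw [← hφ, ← hσ]
  rfl

theorem trdeg_algebraicClosure_ratFunc_le_one (K : Type*) [Field K] :
    Algebra.trdeg K (AlgebraicClosure (RatFunc K)) ≤ 1 := by
  have : Algebra.IsAlgebraic (Polynomial K) (RatFunc K) :=
    IsLocalization.isAlgebraic _ (nonZeroDivisors (Polynomial K))
  rw [← trdeg_add_eq K (RatFunc K) (A := AlgebraicClosure (RatFunc K)),
    trdeg_eq_zero (R := RatFunc K), add_zero]
  rw [← trdeg_add_eq K (Polynomial K) (A := RatFunc K),
    trdeg_eq_zero (R := Polynomial K), add_zero, Polynomial.trdeg_of_isDomain]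

section Divisible

variable {F K Ω : Type*} [Field F] [Field K] [Field Ω] [Algebra F K] [Algebra F Ω] [Algebra K Ω]
  [IsScalarTower F K Ω] {W : WeierstrassCurve F}

/-- A point with coordinates in `Ω` whose first coordinate is algebraic over an algebraically closed
subfield `K` has both coordinates in `K`. -/
theorem mem_range_baseChange_of_isAlgebraic [IsAlgClosed K] {x y : Ω} (h : (W⁄Ω).Nonsingular x y)
    (hx : IsAlgebraic K x) : Point.some x y h ∈ (Point.baseChange (W' := W) K Ω).range := by
  obtain ⟨x₀, rfl⟩ := mem_range_algebraMap_of_isAlgebraic hx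
  have hy : IsAlgebraic K y := by
    let p : Polynomial K := Polynomial.X ^ 2 + Polynomial.C ((W⁄K).a₁ * x₀ + (W⁄K).a₃) * Polynomial.X
      - Polynomial.C (x₀ ^ 3 + (W⁄K).a₂ * x₀ ^ 2 + (W⁄K).a₄ * x₀ + (W⁄K).a₆)
    have hp : p.Monic := by
      simp only [p]
      monicity!
    refine ⟨p, hp.ne_zero, ?_⟩
    have he := ((W⁄Ω).equation_iff' _ _).1 h.1
    have hmap (a : F) : algebraMap K Ω (algebraMap F K a) = algebraMap F Ω a :=
      (IsScalarTower.algebraMap_apply F K Ω a).symm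
    simp only [WeierstrassCurve.baseChange, WeierstrassCurve.map_a₁, WeierstrassCurve.map_a₂,
      WeierstrassCurve.map_a₃, WeierstrassCurve.map_a₄, WeierstrassCurve.map_a₆] at he
    simp only [p, map_add, map_sub, map_mul, map_pow, Polynomial.aeval_X, Polynomial.aeval_C,
      WeierstrassCurve.baseChange, WeierstrassCurve.map_a₁, WeierstrassCurve.map_a₂,
      WeierstrassCurve.map_a₃, WeierstrassCurve.map_a₄, WeierstrassCurve.map_a₆, hmap]
    linear_combination he
  obtain ⟨y₀, rfl⟩ := mem_range_algebraMap_of_isAlgebraic hy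
  exact ⟨.some x₀ y₀ ((WeierstrassCurve.Affine.baseChange_nonsingular W (f := Algebra.ofId K Ω)
    (algebraMap K Ω).injective x₀ y₀).1 h), rfl⟩

/-- Two points which are not rational over the algebraically closed field `K` are conjugate up to
sign, in an algebraically closed extension of transcendence degree at most one. -/
theorem exists_map_eq_or_eq_neg [IsAlgClosed K] [IsAlgClosed Ω] (htr : Algebra.trdeg K Ω ≤ 1)
    {P Q : (W⁄Ω).Point} (hP : P ∉ (Point.baseChange (W' := W) K Ω).range)
    (hQ : Q ∉ (Point.baseChange (W' := W) K Ω).range) :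
    ∃ σ : Ω →ₐ[K] Ω, Point.map (W' := W) σ P = Q ∨ Point.map (W' := W) σ P = -Q := by
  rcases P with _ | ⟨x, y, h⟩
  · exact absurd (zero_mem _) hP
  rcases Q with _ | ⟨x', y', h'⟩
  · exact absurd (zero_mem _) hQ
  obtain ⟨σ, hσ⟩ := exists_algHom_apply_eq_of_transcendental htr
    (fun hx => hP (mem_range_baseChange_of_isAlgebraic h hx))
    (fun hx => hQ (mem_range_baseChange_of_isAlgebraic h' hx))
  exact ⟨σ, Point.X_eq_iff.1 hσ⟩

/-- An elliptic curve has a point over `Ω` which is not rational over `K`, as soon as `Ω` is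
algebraically closed and transcendental over `K`. -/
theorem exists_notMem_range_baseChange [IsAlgClosed Ω] [W.IsElliptic] {x : Ω}
    (hx : Transcendental K x) :
    ∃ P : (W⁄Ω).Point, P ∉ (Point.baseChange (W' := W) K Ω).range := by
  let p : Polynomial Ω := Polynomial.X ^ 2 + Polynomial.C ((W⁄Ω).a₁ * x + (W⁄Ω).a₃) * Polynomial.X
      - Polynomial.C (x ^ 3 + (W⁄Ω).a₂ * x ^ 2 + (W⁄Ω).a₄ * x + (W⁄Ω).a₆)
  have hp : p.natDegree = 2 := by
    simp only [p]
    compute_degree!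
  obtain ⟨y, hy⟩ := IsAlgClosed.exists_root p (by
    rw [Polynomial.degree_eq_natDegree (fun h => by simp [h] at hp), hp]; decide)
  have he : (W⁄Ω).Equation x y := by
    rw [equation_iff']
    simp only [p, Polynomial.IsRoot.def, Polynomial.eval_sub, Polynomial.eval_add,
      Polynomial.eval_mul, Polynomial.eval_pow, Polynomial.eval_X, Polynomial.eval_C] at hy
    linear_combination hy
  have : (W⁄Ω).IsElliptic := inferInstanceAs (W.map (algebraMap F Ω)).IsElliptic
  refine ⟨.some x y (equation_iff_nonsingular.1 he), ?_⟩
  rintro ⟨_ | ⟨x₀, y₀, h₀⟩, hP⟩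
  · exact Point.some_ne_zero _ hP.symm
  · rw [Point.map_some, Point.some.injEq] at hP
    exact hx (hP.1 ▸ isAlgebraic_algebraMap x₀)

/-- Multiplication by `m` is surjective on the points of an elliptic curve over an algebraically
closed field, provided that it is not degenerate on points (it has at least two nonzero values).
The image of a generic point is again generic, all generic points are conjugate up to sign, and
every rational point is the difference of two generic ones. -/
theorem exists_nsmul_eq_of_isAlgClosed [IsAlgClosed K] [W.IsElliptic] {m : ℕ}
    (hm : ∀ Z : (W⁄K).Point, ∃ T : (W⁄K).Point, m • T ≠ 0 ∧ m • T ≠ Z) (R : (W⁄K).Point) :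
    ∃ P : (W⁄K).Point, m • P = R := by
  let Ω := AlgebraicClosure (RatFunc K)
  have : IsScalarTower F K Ω := inferInstance
  have htr : Algebra.trdeg K Ω ≤ 1 := trdeg_algebraicClosure_ratFunc_le_one K
  let B := (Point.baseChange (W' := W) K Ω).range
  have hinj : Function.Injective (Point.baseChange (W' := W) K Ω) := Point.map_injective _
  have hgen : ∀ P : (W⁄Ω).Point, P ∉ B → m • P ∉ B := by
    rintro P hP ⟨S, hS⟩
    -- if `m • P = S` is rational, then `m • Q = ± S` for all generic `Q`, in particular for `P + T`
    obtain ⟨T, hT0, hT⟩ := hm (-(2 • S))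
    have hQ : P + Point.baseChange K Ω T ∉ B := fun h =>
      hP ((B.add_mem_cancel_right ⟨T, rfl⟩).1 h)
    obtain ⟨σ, hσ⟩ := exists_map_eq_or_eq_neg htr hP hQ
    have h1 : m • Point.map (W' := W) σ P = Point.baseChange K Ω S := by
      rw [← map_nsmul, ← hS]
      exact Point.map_baseChange σ S
    rcases hσ with hσ | hσ
    · rw [hσ, smul_add, ← hS, add_eq_left, ← map_nsmul] at h1
      exact hT0 (hinj (h1.trans (map_zero _).symm))
    · rw [hσ, smul_neg, smul_add, ← hS, ← map_nsmul, neg_eq_iff_eq_neg] at h1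
      refine hT (hinj ?_)
      rw [map_neg, map_nsmul _ 2, two_nsmul, neg_add]
      exact eq_sub_of_add_eq' h1
  have hdiv : ∀ P Q : (W⁄Ω).Point, P ∉ B → Q ∉ B → ∃ U, m • U = Q := by
    intro P Q hP hQ
    obtain ⟨σ, hσ | hσ⟩ := exists_map_eq_or_eq_neg htr (hgen P hP) hQ
    · exact ⟨_, (map_nsmul _ _ _).symm.trans hσ⟩
    · exact ⟨-Point.map (W' := W) σ P, by rw [neg_nsmul, ← map_nsmul, hσ, neg_neg]⟩
  obtain ⟨P, hP⟩ := exists_notMem_range_baseChange (K := K) (W := W) (x := algebraMap (RatFunc K) Ω RatFunc.X)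
    (by
      rw [transcendental_algebraMap_iff (algebraMap (RatFunc K) Ω).injective]
      exact RatFunc.transcendental_X)
  obtain ⟨U, hU⟩ := hdiv P _ hP hP
  obtain ⟨V, hV⟩ := hdiv P (Point.baseChange K Ω R + P) hP fun h =>
    hP ((B.add_mem_cancel_left ⟨R, rfl⟩).1 h)
  have hVU : m • (V - U) = Point.baseChange K Ω R := by rw [nsmul_sub, hU, hV, add_sub_cancel_right]
  have hmem : V - U ∈ B := by
    by_contra h
    exact hgen _ h (hVU ▸ ⟨R, rfl⟩)
  obtain ⟨S, hS⟩ := hmem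
  exact ⟨S, hinj (by rw [map_nsmul, ← hVU, ← hS])⟩

end Divisible

/-! ### Submodules and cocycles for `GL₂` -/

section GLTwo

open Matrix

variable {R : Type*} [CommRing R]

/-- The elementary matrix `(1 a; 0 1)`. -/
noncomputable def upperUnipotent (a : R) : GL (Fin 2) R :=
  GeneralLinearGroup.mk'' !![1, a; 0, 1] (by simp)

/-- The elementary matrix `(1 0; a 1)`. -/
noncomputable def lowerUnipotent (a : R) : GL (Fin 2) R :=
  GeneralLinearGroup.mk'' !![1, 0; a, 1] (by simp)

/-- The diagonal matrix `(u 0; 0 v)`. -/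
noncomputable def diagTwo (u v : Rˣ) : GL (Fin 2) R :=
  GeneralLinearGroup.mk'' !![(u : R), 0; 0, v] (by simp)

variable (R) in
/-- The permutation matrix `(0 1; 1 0)`. -/
noncomputable def swapTwo : GL (Fin 2) R :=
  GeneralLinearGroup.mk'' !![0, 1; 1, 0] (by simp)

@[simp]
theorem coe_upperUnipotent (a : R) :
    (upperUnipotent a : Matrix (Fin 2) (Fin 2) R) = !![1, a; 0, 1] := rfl

@[simp]
theorem coe_lowerUnipotent (a : R) :
    (lowerUnipotent a : Matrix (Fin 2) (Fin 2) R) = !![1, 0; a, 1] := rfl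

@[simp]
theorem coe_diagTwo (u v : Rˣ) :
    (diagTwo u v : Matrix (Fin 2) (Fin 2) R) = !![(u : R), 0; 0, v] := rfl

@[simp]
theorem coe_swapTwo : (swapTwo R : Matrix (Fin 2) (Fin 2) R) = !![0, 1; 1, 0] := rfl

/-- An additive subgroup of `R²` stable under `GL₂(R)` which contains a vector with an invertible
coordinate is everything. -/
theorem eq_top_of_mulVec_mem {S : AddSubgroup (Fin 2 → R)}
    (hS : ∀ (g : GL (Fin 2) R), ∀ v ∈ S, (g : Matrix (Fin 2) (Fin 2) R) *ᵥ v ∈ S)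
    {v : Fin 2 → R} (hv : v ∈ S) {i : Fin 2} (hi : IsUnit (v i)) : S = ⊤ := by
  have hswap : ∀ w ∈ S, ![w 1, w 0] ∈ S := by
    intro w hw
    convert hS (swapTwo R) w hw using 1
    ext j
    fin_cases j <;> simp [Matrix.mulVec, dotProduct]
  wlog h0 : i = 0 generalizing v i
  · obtain rfl : i = 1 := by omega
    exact this (hswap v hv) (i := 0) (by simpa using hi) rfl
  subst h0
  have hsnd : ∀ a : R, ![0, a] ∈ S := by
    intro a
    obtain ⟨u, hu⟩ := hi
    convert S.sub_mem (hS (lowerUnipotent (a * ↑u⁻¹)) v hv) hv using 1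
    ext j
    fin_cases j <;> simp [dotProduct, ← hu, mul_assoc]
  rw [eq_top_iff]
  intro w _
  convert S.add_mem (hswap _ (hsnd (w 0))) (hsnd (w 1)) using 1
  ext j
  fin_cases j <;> simp

/-- Entrywise congruence of a matrix to the identity modulo `m`. -/
def CongrOne (m : R) (g : GL (Fin 2) R) : Prop :=
  ∀ i j, m ∣ (g - 1 : Matrix (Fin 2) (Fin 2) R) i j

theorem congrOne_iff {m : R} {g : GL (Fin 2) R} :
    CongrOne m g ↔ m ∣ g 0 0 - 1 ∧ m ∣ g 0 1 ∧ m ∣ g 1 0 ∧ m ∣ g 1 1 - 1 := by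
  simp [CongrOne, Fin.forall_fin_two, and_assoc]

/-- Let `c` be a cocycle on `GL₂(R)` with values killed by `2`, on which the matrices congruent to
`1` modulo `2` act trivially and no nonzero value is fixed by both `(0 1; 1 0)` and `(1 1; 0 1)`.
Then `c` vanishes on the matrices congruent to `1` modulo `4`.

On the matrices congruent to `1` modulo `2` the cocycle is an equivariant homomorphism, so it kills
squares and scalars. A diagonal matrix congruent to `1` modulo `4` is conjugate to its inverse up
to a scalar, and to itself up to a square, which forces its value to be fixed. -/
theorem cocycle_eq_zero_of_congrOne_four {V : Type*} [AddCommGroup V]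
    (hR : ∀ x : R, IsUnit (1 + 4 * x)) (act : GL (Fin 2) R → V →+ V) (c : GL (Fin 2) R → V)
    (hc : ∀ g h, c (g * h) = c g + act g (c h)) (htwo : ∀ g, c g + c g = 0)
    (htriv : ∀ g h, CongrOne 2 g → act g (c h) = c h)
    (hfix : ∀ h, act (swapTwo R) (c h) = c h → act (upperUnipotent 1) (c h) = c h → c h = 0)
    {g : GL (Fin 2) R} (hg : CongrOne 4 g) : c g = 0 := by
  have hmul : ∀ g h, CongrOne 2 g → c (g * h) = c g + c h := fun g h hg => by
    rw [hc, htriv g h hg]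
  have hconj : ∀ g h h', CongrOne 2 h' → g * h = h' * g → act g (c h) = c h' := by
    intro g h h' hh' e
    have := hc g h
    rw [e, hmul _ _ hh', add_comm] at this
    exact (add_left_cancel this).symm
  have h24 : ∀ {g : GL (Fin 2) R}, CongrOne 4 g → CongrOne 2 g := fun hg i j =>
    (Dvd.intro 2 (by norm_num)).trans (hg i j)
  have hup : ∀ x : R, c (upperUnipotent (4 * x)) = 0 := by
    intro x
    have e : upperUnipotent (4 * x) = upperUnipotent (2 * x) * upperUnipotent (2 * x) := by
      ext i j; fin_cases i <;> fin_cases j <;> simp; ring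
    rw [e, hmul _ _ (congrOne_iff.2 (by simp)), htwo]
  have hlow : ∀ x : R, c (lowerUnipotent (4 * x)) = 0 := by
    intro x
    have e : lowerUnipotent (4 * x) = lowerUnipotent (2 * x) * lowerUnipotent (2 * x) := by
      ext i j; fin_cases i <;> fin_cases j <;> simp; ring
    rw [e, hmul _ _ (congrOne_iff.2 (by simp)), htwo]
  have hscal : ∀ u : Rˣ, 4 ∣ (u : R) - 1 → c (diagTwo u u) = 0 := by
    intro u hu
    have h2 : CongrOne 2 (diagTwo u u) := h24 (congrOne_iff.2 (by simp [hu]))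
    refine hfix _ (hconj _ _ _ h2 ?_) (hconj _ _ _ h2 ?_) <;>
      (ext i j; fin_cases i <;> fin_cases j <;> simp)
  have hdiag : ∀ u v : Rˣ, 4 ∣ (u : R) - 1 → 4 ∣ (v : R) - 1 → c (diagTwo u v) = 0 := by
    intro u v hu hv
    have h2 : CongrOne 2 (diagTwo u v) := h24 (congrOne_iff.2 (by simp [hu, hv]))
    have h2' : CongrOne 2 (diagTwo v u) := h24 (congrOne_iff.2 (by simp [hu, hv]))
    refine hfix _ ?_ ?_
    · rw [hconj _ _ (diagTwo v u) h2' (by ext i j; fin_cases i <;> fin_cases j <;> simp)]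
      have hs := hscal (u * v) (by
        have := (hu.mul_right (v : R)).add hv
        convert this using 1; push_cast; ring)
      have e : diagTwo (u * v) (u * v) = diagTwo v u * diagTwo u v := by
        ext i j; fin_cases i <;> fin_cases j <;> simp [mul_comm]
      rw [e, hmul _ _ h2'] at hs
      exact (add_right_cancel (hs.trans (htwo _).symm))
    · obtain ⟨x, hx⟩ := hv.sub hu
      have hvu : (v : R) = u + 4 * x := by linear_combination hx
      have h2'' : CongrOne 2 (diagTwo u v * upperUnipotent (4 * (↑u⁻¹ * x))) := by
        refine h24 (congrOne_iff.2 ?_)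
        simp [hu, hv, mul_left_comm (u : R) 4]
      rw [hconj _ _ _ h2'' ?_, hmul _ _ h2, hup, add_zero]
      ext i j; fin_cases i <;> fin_cases j <;> simp [hvu, mul_left_comm (u : R) 4, add_comm]
  obtain ⟨⟨p, hp⟩, ⟨q, hq⟩, ⟨s, hs⟩, ⟨t, ht⟩⟩ := congrOne_iff.1 hg
  obtain ⟨u, hu⟩ := hR p
  -- the Gauss decomposition `g = lower * diagonal * upper`, all three congruent to `1` modulo `4`
  obtain ⟨v, hv⟩ := hR (t - 4 * (s * ↑u⁻¹ * q))
  have e : g = lowerUnipotent (4 * (s * ↑u⁻¹)) * (diagTwo u v * upperUnipotent (4 * (↑u⁻¹ * q))) := by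
    have h1 : (u : R) * ↑u⁻¹ = 1 := by simp
    ext i j
    fin_cases i <;> fin_cases j <;> simp [Matrix.mul_apply, Fin.sum_univ_two]
    · linear_combination hp - hu
    · linear_combination hq - 4 * q * h1
    · linear_combination hs - 4 * s * h1
    · linear_combination ht - hv - 16 * s * q * ↑u⁻¹ * h1
  have h4u : (4 : R) ∣ u - 1 := ⟨p, by rw [hu]; ring⟩
  have h4v : (4 : R) ∣ v - 1 := ⟨t - 4 * (s * ↑u⁻¹ * q), by rw [hv]; ring⟩
  rw [e, hmul _ _ (h24 (congrOne_iff.2 (by simp))), hlow, zero_add, hmul _ _ (h24 (congrOne_iff.2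
    (by simp [h4u, h4v]))), hup, hdiag u v h4u h4v, add_zero]

/-- Let `k` be a cocycle with values in `R²` for a surjective representation `r` onto `GL₂(R)`. If
`k` takes on `ker r` a value with an invertible coordinate, then `k` maps `ker r` onto `R²`: the
image of `ker r` is a subgroup stable under `GL₂(R)`. -/
theorem cocycle_surjective_on_ker {G : Type*} [Group G] {r : G →* GL (Fin 2) R}
    (hr : Function.Surjective r) {k : G → Fin 2 → R}
    (hk : ∀ g h, k (g * h) = k g + (r g : Matrix (Fin 2) (Fin 2) R) *ᵥ k h) {n : G} (hn : r n = 1)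
    {i : Fin 2} (hi : IsUnit (k n i)) (v : Fin 2 → R) : ∃ m, r m = 1 ∧ k m = v := by
  have hk1 : k 1 = 0 := by simpa using hk 1 1
  have hinv : ∀ g, k g = -((r g : Matrix (Fin 2) (Fin 2) R) *ᵥ k g⁻¹) := fun g => by
    rw [eq_neg_iff_add_eq_zero, ← hk, mul_inv_cancel, hk1]
  let S : AddSubgroup (Fin 2 → R) :=
    { carrier := {w | ∃ m, r m = 1 ∧ k m = w}
      zero_mem' := ⟨1, map_one r, hk1⟩
      add_mem' := by
        rintro _ _ ⟨m, hm, rfl⟩ ⟨m', hm', rfl⟩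
        exact ⟨m * m', by rw [map_mul, hm, hm', one_mul], by rw [hk, hm]; simp⟩
      neg_mem' := by
        rintro _ ⟨m, hm, rfl⟩
        exact ⟨m⁻¹, by rw [map_inv, hm, inv_one], by rw [hinv m, hm]; simp⟩ }
  have hS : ∀ (g : GL (Fin 2) R), ∀ w ∈ S, (g : Matrix (Fin 2) (Fin 2) R) *ᵥ w ∈ S := by
    rintro g _ ⟨m, hm, rfl⟩
    obtain ⟨h, rfl⟩ := hr g
    refine ⟨h * (m * h⁻¹), by simp [hm], ?_⟩
    rw [hk, hk, hm, hinv h, Units.val_one, one_mulVec, mulVec_add]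
    abel
  have htop : S = ⊤ := eq_top_of_mulVec_mem hS (v := k n) ⟨n, hn, rfl⟩ hi
  exact (htop ▸ AddSubgroup.mem_top v : v ∈ S)

end GLTwo

section Cocycle

/-- A cocycle with values killed by an odd number is a coboundary as soon as some `z`, central as
far as the cocycle can see, acts as `-1`: comparing `c (z * g)` with `c (g * z)` expresses `2 • c g`
through `c z`. -/
theorem exists_eq_sub_of_central_neg {G V : Type*} [Group G] [AddCommGroup V] (act : G → V →+ V)
    (c : G → V) (hc : ∀ g h, c (g * h) = c g + act g (c h)) {m : ℕ} (hm : Odd m)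
    (hkill : ∀ g, m • c g = 0) (z : G) (hz : ∀ g, c (z * g) = c (g * z))
    (hneg : ∀ g, act z (c g) = -c g) : ∃ D : V, m • D = 0 ∧ ∀ g, c g = D - act g D := by
  obtain ⟨k, rfl⟩ := hm
  refine ⟨(k + 1) • c z, by rw [smul_comm, hkill, smul_zero], fun g => ?_⟩
  have h1 : 2 • c g = c z - act g (c z) := by
    have := hz g
    rw [hc, hc, hneg] at this
    rw [two_nsmul, eq_sub_iff_add_eq, add_assoc, ← this]
    abel
  calc c g = (k + 1) • (2 • c g) := by
        rw [smul_smul, show (k + 1) * 2 = (2 * k + 1) + 1 by ring, add_smul, hkill, zero_add,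
          one_smul]
    _ = _ := by rw [h1, smul_sub, map_nsmul]

end Cocycle

/-! ### Tate modules in coordinates -/

theorem PadicInt.not_isUnit_iff_dvd {p : ℕ} [Fact p.Prime] {x : ℤ_[p]} :
    ¬IsUnit x ↔ (p : ℤ_[p]) ∣ x := by
  rw [PadicInt.not_isUnit_iff, PadicInt.norm_lt_one_iff_dvd]

section Tate

variable {ℓ : ℕ} {M : Type*} [AddCommGroup M]

/-- If multiplication by `ℓ` is surjective, then every `ℓ ^ n`-torsion element is the `n`-th term of
an element of the Tate module. -/
theorem TateModule.exists_apply_eq (hM : ∀ x : M, ∃ y, ℓ • y = x) {n : ℕ} {P : M}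
    (hP : ℓ ^ n • P = 0) : ∃ x : TateModule ℓ M, x.1 n = P := by
  choose d hd using hM
  have hpow : ∀ k, ℓ ^ k • d^[k] P = P := by
    intro k
    induction k with
    | zero => simp
    | succ k ih => rw [Function.iterate_succ_apply', pow_succ, mul_smul, hd, ih]
  refine ⟨⟨fun k => ℓ ^ n • d^[k] P, by simpa using hP, fun k => ?_⟩, hpow n⟩
  dsimp only
  rw [Function.iterate_succ_apply', smul_comm, hd]

variable [Fact ℓ.Prime]

/-- The `n`-th term of an element of the Tate module vanishes exactly when the element is divisible
by `ℓ ^ n`, that is, when its coordinates are. -/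
theorem TateModule.apply_eq_zero_iff {ι : Type*} [Fintype ι]
    (b : Module.Basis ι ℤ_[ℓ] (TateModule ℓ M)) {x : TateModule ℓ M} {n : ℕ} :
    x.1 n = 0 ↔ ∀ i, (ℓ : ℤ_[ℓ]) ^ n ∣ b.equivFun x i := by
  constructor
  · intro hx i
    have hshift : ∀ k, ℓ ^ n • x.1 (k + n) = x.1 k := by
      intro k
      induction n generalizing k with
      | zero => simp
      | succ n ih =>
        have hn : x.1 n = 0 := by rw [← x.2.2 n, hx, smul_zero]
        rw [pow_succ, mul_smul, ← add_assoc, x.2.2, ih hn]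
    let y : TateModule ℓ M := ⟨fun k => x.1 (k + n), by simpa using hx, fun k => by
      dsimp only
      rw [add_right_comm, x.2.2]⟩
    have hxy : x = ((ℓ : ℤ_[ℓ]) ^ n) • y := by
      rw [← Nat.cast_pow, Nat.cast_smul_eq_nsmul]
      ext k
      exact (hshift k).symm
    rw [hxy, map_smul]
    exact ⟨_, rfl⟩
  · intro h
    choose a ha using h
    have hxy : x = ((ℓ : ℤ_[ℓ]) ^ n) • b.equivFun.symm a := by
      apply b.equivFun.injective
      rw [map_smul, LinearEquiv.apply_symm_apply]
      ext i
      simpa using ha i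
    rw [hxy, ← Nat.cast_pow, Nat.cast_smul_eq_nsmul]
    exact TateModule.pow_smul_eq_zero _ n

theorem TateModule.apply_one_ne_zero_of_basis {ι : Type*} [Fintype ι]
    (b : Module.Basis ι ℤ_[ℓ] (TateModule ℓ M)) (i : ι) : (b i).1 1 ≠ 0 := by
  rw [Ne, TateModule.apply_eq_zero_iff b]
  intro h
  have := h i
  simp only [Module.Basis.equivFun_self, if_true, pow_one] at this
  exact PadicInt.not_isUnit_iff_dvd.2 this isUnit_one

end Tate

/-! ### The Galois action on geometric points -/

section Galois

variable {F : Type*} [Field F] {W : WeierstrassCurve F}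

/-- The action of an automorphism of the algebraic closure on the geometric points. -/
noncomputable def geomAct (σ : Gal(AlgebraicClosure F/F)) : GeomPoint W →+ GeomPoint W :=
  Point.map (W' := W) (σ : AlgebraicClosure F →ₐ[F] AlgebraicClosure F)

theorem geomAct_mul (σ τ : Gal(AlgebraicClosure F/F)) (P : GeomPoint W) :
    geomAct (σ * τ) P = geomAct σ (geomAct τ P) :=
  (Point.map_map (W' := W) (τ : AlgebraicClosure F →ₐ[F] AlgebraicClosure F)
    (σ : AlgebraicClosure F →ₐ[F] AlgebraicClosure F) P).symm

theorem geomAct_baseChange (σ : Gal(AlgebraicClosure F/F)) (α : (W⁄F).Point) :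
    geomAct σ (Point.baseChange F (AlgebraicClosure F) α) =
      Point.baseChange F (AlgebraicClosure F) α :=
  Point.map_baseChange (W' := W) _ α

theorem pointField_le_iff {P : GeomPoint W} {L : IntermediateField F (AlgebraicClosure F)} :
    pointField P ≤ L ↔ ∀ x ∈ coords P, x ∈ L :=
  IntermediateField.adjoin_le_iff

theorem torsionField_le_iff {m : ℕ} {L : IntermediateField F (AlgebraicClosure F)} :
    torsionField W m ≤ L ↔ ∀ P : GeomPoint W, m • P = 0 → pointField P ≤ L := by
  simp only [torsionField, IntermediateField.adjoin_le_iff, Set.iUnion_subset_iff, Set.mem_ofPred_eq,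
    pointField]

theorem torsionFieldInfty_le_iff {ℓ : ℕ} {L : IntermediateField F (AlgebraicClosure F)} :
    torsionFieldInfty W ℓ ≤ L ↔
      ∀ (n : ℕ) (P : GeomPoint W), ℓ ^ n • P = 0 → pointField P ≤ L := by
  simp only [torsionFieldInfty, iSup_le_iff, torsionField_le_iff]

theorem torsionField_le_torsionFieldInfty (ℓ n : ℕ) :
    torsionField W (ℓ ^ n) ≤ torsionFieldInfty W ℓ :=
  le_iSup (fun n => torsionField W (ℓ ^ n)) n

theorem kummerFieldInfty_le_iff {ℓ : ℕ} {β : ℕ → GeomPoint W}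
    {L : IntermediateField F (AlgebraicClosure F)} :
    kummerFieldInfty ℓ β ≤ L ↔ torsionFieldInfty W ℓ ≤ L ∧ ∀ n, pointField (β n) ≤ L := by
  simp only [kummerFieldInfty, torsionFieldInfty, iSup_le_iff, sup_le_iff, forall_and]

theorem geomAct_eq_self_iff {σ : Gal(AlgebraicClosure F/F)} {P : GeomPoint W} :
    geomAct σ P = P ↔ σ ∈ (pointField P).fixingSubgroup := by
  rw [← Subgroup.zpowers_le, ← IntermediateField.le_iff_le, pointField_le_iff]
  have hfix : ∀ x, x ∈ IntermediateField.fixedField (Subgroup.zpowers σ) ↔ σ x = x := fun x => by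
    rw [IntermediateField.mem_fixedField_iff]
    refine ⟨fun h => h σ (Subgroup.mem_zpowers σ), fun h τ hτ => ?_⟩
    exact (Subgroup.zpowers_le (H := MulAction.stabilizer _ x)).2 h hτ
  simp only [hfix]
  rcases P with _ | ⟨x, y, h⟩
  · simp only [coords, Set.mem_empty_iff_false, false_imp_iff, implies_true, iff_true]
    rfl
  · simp only [coords, Set.mem_insert_iff, Set.mem_singleton_iff, forall_eq_or_imp, forall_eq]
    change Point.some _ _ _ = Point.some _ _ _ ↔ _
    rw [Point.some.injEq]
    rfl

theorem pointField_le_comap {σ : Gal(AlgebraicClosure F/F)} {P : GeomPoint W}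
    {L : IntermediateField F (AlgebraicClosure F)} (h : pointField (geomAct σ P) ≤ L) :
    pointField P ≤ L.comap (σ : AlgebraicClosure F →ₐ[F] AlgebraicClosure F) := by
  rw [pointField_le_iff] at h ⊢
  rcases P with _ | ⟨x, y, hP⟩
  · rintro x ⟨⟩
  · rintro z (rfl | rfl)
    · exact h _ (Or.inl rfl)
    · exact h _ (Or.inr rfl)

theorem pointField_le_of_forall_geomAct [CharZero F] {P : GeomPoint W}
    {L : IntermediateField F (AlgebraicClosure F)}
    (h : ∀ σ ∈ L.fixingSubgroup, geomAct σ P = P) : pointField P ≤ L := by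
  rw [← InfiniteGalois.fixedField_fixingSubgroup L, IntermediateField.le_iff_le]
  exact fun σ hσ => geomAct_eq_self_iff.1 (h σ hσ)

theorem exists_baseChange_eq_of_forall_geomAct [CharZero F] {P : GeomPoint W}
    (h : ∀ σ, geomAct σ P = P) :
    ∃ γ : (W⁄F).Point, Point.baseChange F (AlgebraicClosure F) γ = P := by
  have hP : pointField P ≤ ⊥ := pointField_le_of_forall_geomAct fun σ _ => h σ
  rw [pointField_le_iff] at hP
  rcases P with _ | ⟨x, y, hxy⟩
  · exact ⟨0, rfl⟩
  · obtain ⟨x₀, rfl⟩ := IntermediateField.mem_bot.1 (hP x (Or.inl rfl))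
    obtain ⟨y₀, rfl⟩ := IntermediateField.mem_bot.1 (hP y (Or.inr rfl))
    exact ⟨.some x₀ y₀ ((WeierstrassCurve.Affine.baseChange_nonsingular W
      (f := Algebra.ofId F (AlgebraicClosure F)) (algebraMap F _).injective x₀ y₀).1 hxy), rfl⟩

/-- The action of `Gal(L/F)` on `A(L)` is computed by any extension to the algebraic closure. -/
theorem coe_galAct_eq_geomAct {L : IntermediateField F (AlgebraicClosure F)} {σ : L ≃ₐ[F] L}
    {τ : Gal(AlgebraicClosure F/F)} (h : ∀ x : L, τ x = σ x) (P : pointsOver W L) :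
    (galAct σ P).1 = geomAct τ P.1 := by
  obtain ⟨Q, rfl⟩ := (pointsOverEquiv W L).surjective P
  rcases Q with _ | ⟨x, y, hxy⟩
  · exact (congrArg Subtype.val (map_zero (galAct σ))).trans (map_zero (geomAct τ)).symm
  · rw [galAct_some]
    exact ((Point.some.injEq ..).mpr ⟨(h x).symm, (h y).symm⟩)

variable (W) in
theorem normal_torsionFieldInfty (ℓ : ℕ) : Normal F (torsionFieldInfty W ℓ) := by
  rw [IntermediateField.normal_iff_forall_map_le']
  intro σ
  rw [IntermediateField.map_le_iff_le_comap, torsionFieldInfty_le_iff]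
  intro n P hP
  refine pointField_le_comap ((pointField_le_torsionField ?_).trans
    (torsionField_le_torsionFieldInfty ℓ n))
  rw [← map_nsmul, hP, map_zero]

end Galois

/-! ### The Kummer cocycle on the absolute Galois group -/

section KummerCocycle

variable {F : Type*} [Field F] {W : WeierstrassCurve F} {ℓ : ℕ} {α : (W⁄F).Point}
  {β : ℕ → GeomPoint W} (hβ : IsDivisionSequence ℓ α β)

/-- The Kummer cocycle `σ ↦ (σ(β_n) - β_n)_n` on the whole absolute Galois group. -/
noncomputable def kummerCocycle (σ : Gal(AlgebraicClosure F/F)) :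
    TateModule ℓ (GeomPoint W) :=
  ⟨fun n => geomAct σ (β n) - β n, by
    dsimp only
    rw [hβ.zero, geomAct_baseChange, sub_self], fun n => by
    dsimp only
    rw [nsmul_sub, ← map_nsmul, hβ.succ n]⟩

theorem kummerCocycle_apply (σ : Gal(AlgebraicClosure F/F)) (n : ℕ) :
    (kummerCocycle hβ σ).1 n = geomAct σ (β n) - β n := rfl

theorem kummerCocycle_mul_apply (σ τ : Gal(AlgebraicClosure F/F)) (n : ℕ) :
    (kummerCocycle hβ (σ * τ)).1 n =
      (kummerCocycle hβ σ).1 n + geomAct σ ((kummerCocycle hβ τ).1 n) := by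
  simp only [kummerCocycle_apply, geomAct_mul, map_sub]
  abel

theorem nsmul_kummerCocycle_one (σ : Gal(AlgebraicClosure F/F)) :
    ℓ • (kummerCocycle hβ σ).1 1 = 0 := by
  rw [(kummerCocycle hβ σ).2.2 0, (kummerCocycle hβ σ).2.1]

theorem pointField_le_of_mem_pointsOver {L : IntermediateField F (AlgebraicClosure F)}
    {P : GeomPoint W} (hP : P ∈ pointsOver W L) : pointField P ≤ L := by
  obtain ⟨_ | ⟨x, y, h⟩, rfl⟩ := hP
  · exact pointField_le_iff.2 fun _ h => h.elim
  · refine pointField_le_iff.2 ?_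
    rintro z (rfl | rfl)
    · exact x.2
    · exact y.2

theorem normal_kummerFieldInfty (hβ : IsDivisionSequence ℓ α β) :
    Normal F (kummerFieldInfty ℓ β) := by
  rw [IntermediateField.normal_iff_forall_map_le']
  intro σ
  rw [IntermediateField.map_le_iff_le_comap, kummerFieldInfty_le_iff]
  have hT := torsionFieldInfty_le_kummerFieldInfty ℓ β
  constructor
  · have := IntermediateField.normal_iff_forall_map_le'.1 (normal_torsionFieldInfty W ℓ) σ
    exact IntermediateField.map_le_iff_le_comap.1 (this.trans hT)
  · intro n
    refine pointField_le_comap (pointField_le_of_mem_pointsOver ?_)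
    rw [← sub_add_cancel (geomAct σ (β n)) (β n)]
    exact add_mem (mem_pointsOver ((pointField_tate_le (kummerCocycle hβ σ) n).trans hT))
      (mem_pointsOver_kummer ℓ β n)

theorem kummerMap_eq_kummerCocycle {σ : kummerGroup ℓ β} {τ : Gal(AlgebraicClosure F/F)}
    (h : ∀ x : kummerFieldInfty ℓ β, τ x = σ.1 x) : kummerMap hβ σ = kummerCocycle hβ τ := by
  ext n
  exact congrArg (· - β n) (coe_galAct_eq_geomAct h _)

/-- An `ℓ`-division point of a point of `ℓ A(F)` differs from a rational point by torsion. -/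
theorem pointField_le_torsionFieldInfty_of_eq_nsmul (hβ : IsDivisionSequence ℓ α β)
    (h : ∃ γ : (W⁄F).Point, α = ℓ • γ) : pointField (β 1) ≤ torsionFieldInfty W ℓ := by
  obtain ⟨γ, rfl⟩ := h
  have ht : ℓ ^ 1 • (β 1 - Point.baseChange F (AlgebraicClosure F) γ) = 0 := by
    rw [pow_one, nsmul_sub, hβ.succ, hβ.zero, map_nsmul, sub_self]
  refine pointField_le_of_mem_pointsOver ?_
  rw [← sub_add_cancel (β 1) (Point.baseChange F (AlgebraicClosure F) γ)]
  refine add_mem (mem_pointsOver ((pointField_le_torsionField ht).trans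
    (torsionField_le_torsionFieldInfty ℓ 1))) ?_
  exact ⟨Point.baseChange F _ γ, Point.map_baseChange (W' := W) _ γ⟩

end KummerCocycle

/-! ### The representation of the absolute Galois group and the Kummer map -/

section Kummer

open Matrix

variable {F : Type*} [Field F] {W : WeierstrassCurve F} {ℓ : ℕ} [Fact ℓ.Prime]
  (b : Module.Basis (Fin 2) ℤ_[ℓ] (TateModule ℓ (GeomPoint W)))

/-- The `ℓ`-adic representation, inflated to the absolute Galois group of `F`. -/
noncomputable def absRep : Gal(AlgebraicClosure F/F) →* GL (Fin 2) ℤ_[ℓ] :=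
  haveI := normal_torsionFieldInfty W ℓ
  (ladicRep b).comp (AlgEquiv.restrictNormalHom (torsionFieldInfty W ℓ))

variable {b} in
theorem absRep_surjective [CharZero F] (hρ : Function.Surjective (ladicRep b)) :
    Function.Surjective (absRep b) := by
  have := normal_torsionFieldInfty W ℓ
  exact hρ.comp (AlgEquiv.restrictNormalHom_surjective (AlgebraicClosure F))

/-- The inflated representation describes the termwise action on the Tate module. -/
theorem equivFun_eq_absRep_mulVec {σ : Gal(AlgebraicClosure F/F)}
    {x y : TateModule ℓ (GeomPoint W)} (h : ∀ n, geomAct σ (x.1 n) = y.1 n) :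
    b.equivFun y = (absRep b σ : Matrix (Fin 2) (Fin 2) ℤ_[ℓ]) *ᵥ b.equivFun x := by
  have := normal_torsionFieldInfty W ℓ
  have hy : y = torsionRep W ℓ (σ.restrictNormal (torsionFieldInfty W ℓ)) x := by
    ext n
    rw [← h n]
    exact (coe_galAct_eq_geomAct
      (fun z => (AlgEquiv.restrictNormal_commutes σ (torsionFieldInfty W ℓ) z).symm)
      ⟨x.1 n, mem_pointsOver (pointField_tate_le x n)⟩).symm
  rw [hy]
  exact (LinearMap.toMatrix_mulVec_repr b b _ x).symm

theorem equivFun_symm_absRep_mulVec (σ : Gal(AlgebraicClosure F/F))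
    (x : TateModule ℓ (GeomPoint W)) (n : ℕ) :
    (b.equivFun.symm ((absRep b σ : Matrix (Fin 2) (Fin 2) ℤ_[ℓ]) *ᵥ b.equivFun x)).1 n =
      geomAct σ (x.1 n) := by
  let y : TateModule ℓ (GeomPoint W) := ⟨fun n => geomAct σ (x.1 n), by
    dsimp only
    rw [x.2.1, map_zero], fun n => by
    dsimp only
    rw [← map_nsmul, x.2.2]⟩
  rw [← equivFun_eq_absRep_mulVec b (σ := σ) (x := x) (y := y) fun _ => rfl,
    LinearEquiv.symm_apply_apply]

/-- Divisibility of the group of geometric points by `ℓ`; the elements of the Tate module provide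
the points on which multiplication by `ℓ` is not degenerate. -/
theorem exists_nsmul_eq_geomPoint [W.IsElliptic]
    (b : Module.Basis (Fin 2) ℤ_[ℓ] (TateModule ℓ (GeomPoint W))) (R : GeomPoint W) :
    ∃ P : GeomPoint W, ℓ • P = R := by
  refine exists_nsmul_eq_of_isAlgClosed (fun Z => ?_) R
  have h1 := TateModule.apply_one_ne_zero_of_basis b 0
  have hs := (b 0).2.2
  have h2 : (b 0).1 2 ≠ 0 := fun h => h1 (by rw [← hs 1, h, nsmul_zero])
  by_cases hZ : Z = (b 0).1 1
  · refine ⟨(b 0).1 3, by rwa [hs 2], fun h => h1 ?_⟩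
    rw [hs 2, hZ] at h
    rw [← hs 1, h, hs 0, (b 0).2.1]
  · exact ⟨(b 0).1 2, by rwa [hs 1], fun h => hZ (by rw [← h, hs 1])⟩

/-- The kernel of the inflated representation fixes `T_∞`: by divisibility every torsion point is a
term of an element of the Tate module. -/
theorem mem_fixingSubgroup_of_absRep_eq_one [W.IsElliptic] {σ : Gal(AlgebraicClosure F/F)}
    (hσ : absRep b σ = 1) : σ ∈ (torsionFieldInfty W ℓ).fixingSubgroup := by
  rw [← Subgroup.zpowers_le, ← IntermediateField.le_iff_le, torsionFieldInfty_le_iff]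
  intro n P hP
  rw [IntermediateField.le_iff_le, Subgroup.zpowers_le, ← geomAct_eq_self_iff]
  obtain ⟨x, rfl⟩ := TateModule.exists_apply_eq (exists_nsmul_eq_geomPoint b) hP
  rw [← equivFun_symm_absRep_mulVec b, hσ, Units.val_one, one_mulVec, LinearEquiv.symm_apply_apply]

variable {α : (W⁄F).Point} {β : ℕ → GeomPoint W} (hβ : IsDivisionSequence ℓ α β)

theorem equivFun_kummerCocycle_mul (σ τ : Gal(AlgebraicClosure F/F)) :
    b.equivFun (kummerCocycle hβ (σ * τ)) = b.equivFun (kummerCocycle hβ σ) +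
      (absRep b σ : Matrix (Fin 2) (Fin 2) ℤ_[ℓ]) *ᵥ b.equivFun (kummerCocycle hβ τ) := by
  have h : kummerCocycle hβ (σ * τ) = kummerCocycle hβ σ + b.equivFun.symm
      ((absRep b σ : Matrix (Fin 2) (Fin 2) ℤ_[ℓ]) *ᵥ b.equivFun (kummerCocycle hβ τ)) := by
    ext n
    rw [kummerCocycle_mul_apply, ← equivFun_symm_absRep_mulVec b]
    rfl
  rw [h, map_add, LinearEquiv.apply_symm_apply]

theorem absRep_eq_one_of_mem_fixingSubgroup {σ : Gal(AlgebraicClosure F/F)}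
    (hσ : σ ∈ (torsionFieldInfty W ℓ).fixingSubgroup) : absRep b σ = 1 := by
  have := normal_torsionFieldInfty W ℓ
  have h1 : AlgEquiv.restrictNormalHom (torsionFieldInfty W ℓ) σ = 1 := by
    ext x
    exact (AlgEquiv.restrictNormal_commutes σ (torsionFieldInfty W ℓ) x).trans
      ((IntermediateField.mem_fixingSubgroup_iff _ _).1 hσ x x.2)
  rw [absRep, MonoidHom.comp_apply, h1, map_one]

/-- When the `ℓ`-adic representation is surjective, the Kummer map is surjective as soon as it is
nonzero modulo `ℓ`, that is, as soon as `β_1` is not defined over `T_∞`. -/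
theorem surjective_kummerMapCoord_iff [CharZero F] [W.IsElliptic] (hρ : Function.Surjective (ladicRep b)) :
    Function.Surjective (kummerMapCoord b hβ) ↔
      ¬ pointField (β 1) ≤ torsionFieldInfty W ℓ := by
  constructor
  · intro hs hle
    obtain ⟨σ, hσ⟩ := hs (b.equivFun (b 0))
    have hσ' : kummerMap hβ σ = b 0 := b.equivFun.injective hσ
    let τ := σ.1.liftNormal (AlgebraicClosure F)
    have hτ : ∀ x : kummerFieldInfty ℓ β, τ x = σ.1 x := AlgEquiv.liftNormal_commutes σ.1 _
    have hfix : geomAct τ (β 1) = β 1 := by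
      rw [geomAct_eq_self_iff, IntermediateField.mem_fixingSubgroup_iff]
      intro x hx
      have hxK := torsionFieldInfty_le_kummerFieldInfty ℓ β (hle hx)
      have h := hτ ⟨x, hxK⟩
      rwa [(IntermediateField.mem_fixingSubgroup_iff _ _).1 σ.2 ⟨x, hxK⟩
        ((IntermediateField.mem_restrict _ _).2 (hle hx))] at h
    apply TateModule.apply_one_ne_zero_of_basis b 0
    rw [← hσ', kummerMap_eq_kummerCocycle hβ hτ, kummerCocycle_apply, hfix, sub_self]
  · intro hle v
    have hn : ∃ σ ∈ (torsionFieldInfty W ℓ).fixingSubgroup, geomAct σ (β 1) ≠ β 1 := by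
      by_contra! h
      exact hle (pointField_le_of_forall_geomAct h)
    obtain ⟨σ, hσ, hne⟩ := hn
    rw [← sub_ne_zero, ← kummerCocycle_apply hβ, Ne, TateModule.apply_eq_zero_iff b,
      not_forall] at hne
    obtain ⟨i, hi⟩ := hne
    rw [pow_one, ← PadicInt.not_isUnit_iff_dvd, not_not] at hi
    obtain ⟨τ, hτ, rfl⟩ := cocycle_surjective_on_ker (absRep_surjective hρ)
      (k := fun σ => b.equivFun (kummerCocycle hβ σ))
      (equivFun_kummerCocycle_mul b hβ) (absRep_eq_one_of_mem_fixingSubgroup b hσ) hi v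
    have := normal_kummerFieldInfty hβ
    have hT := (IntermediateField.mem_fixingSubgroup_iff _ _).1
      (mem_fixingSubgroup_of_absRep_eq_one b hτ)
    refine ⟨⟨τ.restrictNormal (kummerFieldInfty ℓ β), ?_⟩, congrArg b.equivFun
      (kummerMap_eq_kummerCocycle hβ fun x => (AlgEquiv.restrictNormal_commutes τ
        (kummerFieldInfty ℓ β) x).symm)⟩
    rw [IntermediateField.mem_fixingSubgroup_iff]
    intro x hx
    apply Subtype.ext
    exact (AlgEquiv.restrictNormal_commutes τ (kummerFieldInfty ℓ β) x).trans
      (hT x ((IntermediateField.mem_restrict _ _).1 hx))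

theorem kummerCocycle_apply_one_eq_of_absRep_eq [W.IsElliptic]
    (hle : pointField (β 1) ≤ torsionFieldInfty W ℓ) {σ τ : Gal(AlgebraicClosure F/F)}
    (h : absRep b σ = absRep b τ) : (kummerCocycle hβ σ).1 1 = (kummerCocycle hβ τ).1 1 := by
  have hker : absRep b (τ⁻¹ * σ) = 1 := by rw [map_mul, map_inv, h, inv_mul_cancel]
  have hfix : geomAct (τ⁻¹ * σ) (β 1) = β 1 := geomAct_eq_self_iff.2
    (IntermediateField.fixingSubgroup_antitone hle (mem_fixingSubgroup_of_absRep_eq_one b hker))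
  rw [kummerCocycle_apply, kummerCocycle_apply]
  conv_lhs => rw [← mul_inv_cancel_left τ σ, geomAct_mul, hfix]

/-- For odd `ℓ`, an element of the Galois group acting as `-1` on the Tate module shows that the
cocycle of `β_1` over `T_∞` is a coboundary. -/
theorem exists_eq_nsmul_of_odd [CharZero F] [W.IsElliptic]
    (hβ : IsDivisionSequence ℓ α β)
    (hρ : Function.Surjective (ladicRep b)) (hℓ : Odd ℓ)
    (hle : pointField (β 1) ≤ torsionFieldInfty W ℓ) : ∃ γ : (W⁄F).Point, α = ℓ • γ := by
  obtain ⟨z, hz⟩ := absRep_surjective hρ (-1)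
  obtain ⟨D, hD, hcD⟩ := exists_eq_sub_of_central_neg geomAct
    (fun σ => (kummerCocycle hβ σ).1 1) (fun σ τ => kummerCocycle_mul_apply hβ σ τ 1) hℓ
    (nsmul_kummerCocycle_one hβ) z
    (fun σ => kummerCocycle_apply_one_eq_of_absRep_eq b hβ hle (by simp [hz]))
    (fun σ => by
      rw [← equivFun_symm_absRep_mulVec b, hz]
      simp [neg_mulVec])
  obtain ⟨γ, hγ⟩ := exists_baseChange_eq_of_forall_geomAct (P := β 1 + D) fun σ => by
    have h := hcD σ
    rw [kummerCocycle_apply, sub_eq_sub_iff_add_eq_add] at h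
    rw [map_add, h, add_comm]
  refine ⟨γ, Point.map_injective (W' := W) (Algebra.ofId F (AlgebraicClosure F)) ?_⟩
  have h := hβ.succ 0
  rw [hβ.zero] at h
  rw [map_nsmul, hγ, nsmul_add, hD, add_zero]
  exact h.symm

end Kummer

section Two

open Matrix

variable {F : Type*} [Field F] {W : WeierstrassCurve F}
  (b : Module.Basis (Fin 2) ℤ_[2] (TateModule 2 (GeomPoint W)))
  {α : (W⁄F).Point} {β : ℕ → GeomPoint W}

/-- For `ℓ = 2`, the cocycle of `β_1` over `T_∞` vanishes on the automorphisms acting trivially on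
`A[4]`, so that `β_1` is defined over `F(A[4])`. -/
theorem pointField_le_torsionField_four [CharZero F] [W.IsElliptic]
    (hβ : IsDivisionSequence 2 α β)
    (hρ : Function.Surjective (ladicRep b))
    (hle : pointField (β 1) ≤ torsionFieldInfty W 2) : pointField (β 1) ≤ torsionField W 4 := by
  obtain ⟨s, hs⟩ := (absRep_surjective hρ).hasRightInverse
  let k := fun g => b.equivFun (kummerCocycle hβ (s g))
  -- the action of a matrix on a value of the cocycle, read off in coordinates modulo `2`
  have hact : ∀ g h : GL (Fin 2) ℤ_[2], geomAct (s g) ((kummerCocycle hβ (s h)).1 1) =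
      (kummerCocycle hβ (s h)).1 1 ↔ ∀ i, (2 : ℤ_[2]) ∣
        ((g : Matrix (Fin 2) (Fin 2) ℤ_[2]) *ᵥ k h - k h) i := by
    intro g h
    rw [← equivFun_symm_absRep_mulVec b, hs g, ← sub_eq_zero]
    refine (TateModule.apply_eq_zero_iff b (x := b.equivFun.symm _ - kummerCocycle hβ (s h))
      (n := 1)).trans ?_
    rw [map_sub, LinearEquiv.apply_symm_apply, pow_one]
    rfl
  refine pointField_le_of_forall_geomAct fun σ hσ => ?_
  have h4 : CongrOne 4 (absRep b σ) := by
    intro i j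
    have hfix : geomAct σ ((b j).1 2) = (b j).1 2 := geomAct_eq_self_iff.2
      (IntermediateField.fixingSubgroup_antitone
        (pointField_le_torsionField (TateModule.pow_smul_eq_zero (b j) 2)) hσ)
    rw [← equivFun_symm_absRep_mulVec b, ← sub_eq_zero] at hfix
    have h := (TateModule.apply_eq_zero_iff b (x := b.equivFun.symm _ - b j) (n := 2)).1 hfix i
    have hb : b.equivFun (b j) = Pi.single j 1 := by
      ext i
      rw [Module.Basis.equivFun_self, Pi.single_apply]
      simp only [eq_comm]
    rw [map_sub, LinearEquiv.apply_symm_apply, hb, mulVec_single_one] at h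
    convert h using 1
    · norm_num
    · simp [Matrix.one_apply, Pi.single_apply]
  have hR : ∀ x : ℤ_[2], IsUnit (1 + 4 * x) := by
    intro x
    by_contra hx
    rw [PadicInt.not_isUnit_iff_dvd] at hx
    refine PadicInt.not_isUnit_iff_dvd.2 ((dvd_add_left ?_).1 hx) isUnit_one
    exact ⟨2 * x, by push_cast; ring⟩
  have h0 := cocycle_eq_zero_of_congrOne_four hR (fun g => geomAct (s g))
    (fun g => (kummerCocycle hβ (s g)).1 1)
    (fun g h => by
      rw [← kummerCocycle_mul_apply]
      exact kummerCocycle_apply_one_eq_of_absRep_eq b hβ hle (by rw [map_mul, hs, hs, hs]))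
    (fun g => by rw [← two_nsmul]; exact nsmul_kummerCocycle_one hβ _)
    (fun g h hg => by
      rw [hact]
      intro i
      have e : (g : Matrix (Fin 2) (Fin 2) ℤ_[2]) *ᵥ k h - k h =
          (g - 1 : Matrix (Fin 2) (Fin 2) ℤ_[2]) *ᵥ k h := by rw [sub_mulVec, one_mulVec]
      rw [e]
      simp only [mulVec, dotProduct]
      exact Finset.dvd_sum fun j _ => (hg i j).mul_right _)
    (fun h h1 h2 => by
      rw [hact] at h1 h2
      rw [TateModule.apply_eq_zero_iff b]
      have e1 := h1 0
      have e2 := h2 0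
      simp [dotProduct] at e1 e2
      intro i
      rw [pow_one]
      fin_cases i
      · exact (dvd_sub_right e2).1 e1
      · exact e2)
    h4
  rw [kummerCocycle_apply_one_eq_of_absRep_eq b hβ hle (hs (absRep b σ)), kummerCocycle_apply,
    sub_eq_zero] at h0
  exact h0

end Two

/-! ### The surjectivity criterion -/

theorem mainTheorem7 {F : Type*} [Field F] [NumberField F] (W : WeierstrassCurve F) [W.IsElliptic]
    (ℓ : ℕ) [Fact ℓ.Prime] (b : Module.Basis (Fin 2) ℤ_[ℓ] (TateModule ℓ (GeomPoint W)))
    (hρ : Function.Surjective (ladicRep b))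
    (α : (W⁄F).Point) (β : ℕ → GeomPoint W) (hβ : IsDivisionSequence ℓ α β) :
    Function.Surjective (kummerMapCoord b hβ) ↔
      (¬ ∃ γ : (W⁄F).Point, α = ℓ • γ) ∧
        (ℓ = 2 → ¬ pointField (β 1) ≤ torsionField W 4) := by
  rw [surjective_kummerMapCoord_iff b hβ hρ]
  constructor
  · refine fun h => ⟨fun hα => h (pointField_le_torsionFieldInfty_of_eq_nsmul hβ hα), ?_⟩
    rintro rfl h4
    exact h (h4.trans (torsionField_le_torsionFieldInfty 2 2))
  · rintro ⟨h1, h2⟩ hle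
    rcases (Fact.out : ℓ.Prime).eq_two_or_odd' with rfl | hodd
    · exact h2 rfl (pointField_le_torsionField_four b hβ hρ hle)
    · exact h1 (exists_eq_nsmul_of_odd b hβ hρ hodd hle)
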